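/- Let $\alpha\ge 0$, let $p,n,c$ be natural numbers, and let $\mathbb{D}^p_\alpha=\{v\in\mathbb{R}^p : \alpha\|v\|^2<1\}$ be the Poincaré ball (which is $\mathbb{R}^p$ if $\alpha=0$), with $\|\cdot\|$ the Euclidean norm. Define Möbius addition by $$v\oplus_\alpha w=\frac{(1+2\alpha\langle v,w\rangle+\alpha\|w\|^2)\,v+(1-\alpha\|v\|^2)\,w}{1+2\alpha\langle v,w\rangle+\alpha^2\|v\|^2\|w\|^2}$$ and the hyperbolic distance by $$d_H(v,w)=\frac{2}{\sqrt\alpha}\tanh^{-1}\!\bigl(\sqrt\alpha\,\|(-v)\oplus_\alpha w\|\bigr)\quad(\alpha>0),$$ with the limiting value $d_H(v,w)=2\|w-v\|$ for $\alpha=0$. Let $x_1,\dots,x_n\in\mathbb{D}^p_\alpha$, let $m>0$ be real, let $(w_{ij})$ be a real $n\times c$ matrix, and fix $j\in\{1,\dots,c\}$ such that $w_{ij}\ge 0$ for all $i$ and $w_{ij}\neq 0$ for at least one $i$. Then the function $$f(v)=\sum_{i=1}^n (w_{ij})^m\, d_H(x_i,v)^2$$ on $\mathbb{D}^p_\alpha$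 has a unique minimizer: there is exactly one $v_j^*\in\mathbb{D}^p_\alpha$ with $f(v_j^*)\le f(u)$ for all $u\in\mathbb{D}^p_\alpha$. (This point $v_j^*$ is, by definition, the weighted Fréchet mean of the $x_i$ with weights $(w_{ij})^m$.) -/

import Mathlib

namespace HypeFCM

/-- The Poincaré ball `{v ∈ ℝᵖ : α ‖v‖² < 1}`: the open ball of radius `1 / √α` if `α > 0`, and
all of `ℝᵖ` if `α = 0`. -/
def poincareBall (α : ℝ) (p : ℕ) : Set (EuclideanSpace ℝ (Fin p)) :=
  {v | α * ‖v‖ ^ 2 < 1}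

/-- Möbius addition `v ⊕_α w`. -/
noncomputable def mobiusAdd (α : ℝ) {p : ℕ} (v w : EuclideanSpace ℝ (Fin p)) :
    EuclideanSpace ℝ (Fin p) :=
  (1 + 2 * α * inner ℝ v w + α ^ 2 * ‖v‖ ^ 2 * ‖w‖ ^ 2)⁻¹ •
    ((1 + 2 * α * inner ℝ v w + α * ‖w‖ ^ 2) • v + (1 - α * ‖v‖ ^ 2) • w)

/-- The hyperbolic distance `d_H(v, w) = (2 / √α) artanh (√α ‖(-v) ⊕_α w‖)`; for `α = 0`, where
this expression is undefined, its limit `2 ‖(-v) ⊕_0 w‖ = 2 ‖w - v‖` as `α → 0⁺`. -/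
noncomputable def hypDist (α : ℝ) {p : ℕ} (v w : EuclideanSpace ℝ (Fin p)) : ℝ :=
  if α = 0 then 2 * ‖mobiusAdd α (-v) w‖
  else 2 / √α * Real.artanh (√α * ‖mobiusAdd α (-v) w‖)

/-- The function `f(v) = ∑ᵢ (w_ij)ᵐ d_H(xᵢ, v)²` of the `j`-th centroid `v`. -/
noncomputable def centroidObjective (α : ℝ) {p n c : ℕ} (x : Fin n → EuclideanSpace ℝ (Fin p))
    (w : Fin n → Fin c → ℝ) (m : ℝ) (j : Fin c) (v : EuclideanSpace ℝ (Fin p)) : ℝ :=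
  ∑ i, w i j ^ m * hypDist α (x i) v ^ 2

end HypeFCM

/-! Existence holds because `f` is continuous and coercive; uniqueness follows from strict midpoint
convexity of squared distances. If two distinct points were minimizers, their midpoint would lower
every squared distance strictly below the average, hence also `f`, as some weight is positive
(`existsUnique_forall_sum_mul_sq_le`). For `α > 0`, the ball is carried to the unit hyperboloid,
where cosh of the distance is bilinear in the lifted points, so midpoints are normalized sums
(`exists_hyperboloidDist_sq_lt`). For `α = 0`, the parallelogram law suffices. -/

namespace HypeFCM

open Filter Topology

/-! ### Hyperboloid model: midpoint convexity, continuity and coercivity. -/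

section Hyperboloid

variable {E : Type*} [NormedAddCommGroup E]

/-- The height of the point of the unit hyperboloid lying above `y`. -/
noncomputable def height (y : E) : ℝ := √(1 + ‖y‖ ^ 2)

theorem height_pos (y : E) : 0 < height y := by
  unfold height
  positivity

theorem height_sq (y : E) : height y ^ 2 = 1 + ‖y‖ ^ 2 :=
  Real.sq_sqrt (by positivity)

theorem norm_lt_height (y : E) : ‖y‖ < height y :=
  Real.lt_sqrt_of_sq_lt (by linarith)

theorem height_eq_of_sq {y : E} {t : ℝ} (ht : 0 ≤ t) (h : t ^ 2 = 1 + ‖y‖ ^ 2) : height y = t := by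
  rw [height, ← h, Real.sqrt_sq ht]

variable [InnerProductSpace ℝ E]

/-- The negative of the Lorentz product of the points of the unit hyperboloid above `x` and `y`;
it is the hyperbolic cosine of their distance. -/
noncomputable def lorentz (x y : E) : ℝ := height x * height y - inner ℝ x y

theorem inner_sq_le (x y : E) : inner ℝ x y ^ 2 ≤ ‖x‖ ^ 2 * ‖y‖ ^ 2 := by
  rw [← mul_pow]
  exact sq_le_sq.mpr ((abs_real_inner_le_norm x y).trans (le_abs_self _))

theorem one_lt_lorentz {x y : E} (h : x ≠ y) : 1 < lorentz x y := by
  have h1 : 0 < ‖x - y‖ ^ 2 := by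
    have := norm_pos_iff.mpr (sub_ne_zero.mpr h)
    positivity
  rw [norm_sub_sq_real] at h1
  have h2 : (1 + inner ℝ x y) ^ 2 < (height x * height y) ^ 2 := by
    rw [mul_pow, height_sq, height_sq]
    nlinarith [inner_sq_le x y]
  have h3 := abs_lt_of_sq_lt_sq h2 (mul_pos (height_pos x) (height_pos y)).le
  unfold lorentz
  linarith [le_abs_self (1 + inner ℝ x y)]

theorem lorentz_self (x : E) : lorentz x x = 1 := by
  rw [lorentz, ← sq, height_sq, real_inner_self_eq_norm_sq]
  ring

theorem one_le_lorentz (x y : E) : 1 ≤ lorentz x y := by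
  by_cases h : x = y
  · rw [h, lorentz_self]
  · exact (one_lt_lorentz h).le

/-- A vector that is Lorentz orthogonal to a point of the hyperboloid is spacelike. -/
theorem sq_le_norm_sq_of_orthogonal {x y : E} {t : ℝ} (h : height x * t = inner ℝ x y) :
    t ^ 2 ≤ ‖y‖ ^ 2 := by
  have h1 := inner_sq_le x y
  rw [← h, mul_pow, height_sq] at h1
  by_contra! h2
  nlinarith [sq_nonneg ‖x‖, sq_nonneg t]

/-- Cauchy–Schwarz for the components of `u` and `v` Lorentz orthogonal to `x`, where the form is
positive semidefinite. It supplies the triangle inequality `cosh (a - b) ≤ d` for midpoints. -/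
theorem lorentz_gram (x u v : E) :
    (lorentz x u * lorentz x v - lorentz u v) ^ 2 ≤
      (lorentz x u ^ 2 - 1) * (lorentz x v ^ 2 - 1) := by
  have key : ∀ t : ℝ, 0 ≤ (lorentz x v ^ 2 - 1) * (t * t) +
      (2 * (lorentz x u * lorentz x v - lorentz u v)) * t + (lorentz x u ^ 2 - 1) := by
    intro t
    have hx := height_sq x
    have hu := height_sq u
    have hv := height_sq v
    set a := lorentz x u with ha
    set b := lorentz x v with hb
    have ha' : inner ℝ x u = height x * height u - a := by rw [ha, lorentz]; ring
    have hb' : inner ℝ x v = height x * height v - b := by rw [hb, lorentz]; ring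
    have hd' : inner ℝ u v = height u * height v - lorentz u v := by rw [lorentz]; ring
    -- This is the component of `u + t v` orthogonal to `x`; its Lorentz square is the quadratic in
    -- `t`.
    have h := sq_le_norm_sq_of_orthogonal (x := x) (y := (u + t • v) - (a + t * b) • x)
      (t := height u + t * height v - (a + t * b) * height x) (by
        rw [inner_sub_right, inner_add_right, inner_smul_right, inner_smul_right,
          real_inner_self_eq_norm_sq, ha', hb']
        linear_combination (-(a + t * b)) * hx)
    rw [norm_sub_sq_real, norm_add_sq_real, inner_add_left, norm_smul, norm_smul, mul_pow, mul_pow,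
      Real.norm_eq_abs, Real.norm_eq_abs, sq_abs, sq_abs] at h
    simp only [inner_smul_left, inner_smul_right, RCLike.conj_to_real] at h
    rw [real_inner_comm x u, real_inner_comm x v, ha', hb', hd'] at h
    have h4 : ‖x‖ ^ 2 = height x ^ 2 - 1 := by linarith
    have h5 : ‖u‖ ^ 2 = height u ^ 2 - 1 := by linarith
    have h6 : ‖v‖ ^ 2 = height v ^ 2 - 1 := by linarith
    rw [h4, h5, h6] at h
    linarith
  have := discrim_le_zero key
  rw [discrim] at this
  linarith

/-- The projection to the hyperboloid of the midpoint of two of its points. -/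
theorem exists_midpoint (u v : E) :
    ∃ z : E, ∀ x, lorentz x z ^ 2 * (2 * (1 + lorentz u v)) = (lorentz x u + lorentz x v) ^ 2 := by
  have hD := one_le_lorentz u v
  -- `k` is the Lorentz length of the sum of the two lifted points.
  set k := √(2 * (1 + lorentz u v)) with hk
  have hk0 : 0 < k := Real.sqrt_pos.mpr (by linarith)
  have hk2 : k ^ 2 = 2 * (1 + lorentz u v) := Real.sq_sqrt (by linarith)
  have hz : height (k⁻¹ • (u + v)) = k⁻¹ * (height u + height v) := by
    apply height_eq_of_sq
    · have := height_pos u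
      have := height_pos v
      positivity
    · rw [norm_smul, mul_pow, mul_pow, norm_add_sq_real, Real.norm_eq_abs, sq_abs]
      have hu := height_sq u
      have hv := height_sq v
      field_simp
      rw [hk2, lorentz]
      linear_combination hu + hv
  refine ⟨k⁻¹ • (u + v), fun x => ?_⟩
  have : lorentz x (k⁻¹ • (u + v)) = k⁻¹ * (lorentz x u + lorentz x v) := by
    rw [lorentz, hz, inner_smul_right, inner_add_right, lorentz, lorentz]
    ring
  rw [this, ← hk2]
  field_simp

/-- The distance on the unit hyperboloid, parametrized by its horizontal coordinate. -/
noncomputable def hyperboloidDist (x y : E) : ℝ := Real.arcosh (lorentz x y)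

theorem hyperboloidDist_nonneg (x y : E) : 0 ≤ hyperboloidDist x y :=
  Real.arcosh_nonneg (one_le_lorentz x y)

theorem cosh_hyperboloidDist (x y : E) : Real.cosh (hyperboloidDist x y) = lorentz x y :=
  Real.cosh_arcosh (one_le_lorentz x y)

/-- Sum-to-product gives `|c| ≤ (a + b) / 2`. Strictness comes from `1 < d` if `a = b`, and from
strict convexity of the square otherwise. -/
theorem sq_lt_of_cosh_midpoint {a b c d : ℝ} (ha : 0 ≤ a) (hb : 0 ≤ b) (hd : 1 < d)
    (hab : Real.cosh (a - b) ≤ d)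
    (hc : Real.cosh c ^ 2 * (2 * (1 + d)) = (Real.cosh a + Real.cosh b) ^ 2) :
    c ^ 2 < (a ^ 2 + b ^ 2) / 2 := by
  set s := (a + b) / 2 with hs
  set t := (a - b) / 2 with ht
  have h1 : Real.cosh a + Real.cosh b = 2 * Real.cosh s * Real.cosh t := by
    rw [show a = s + t by rw [hs, ht]; ring, show b = s - t by rw [hs, ht]; ring,
      Real.cosh_add, Real.cosh_sub]
    ring
  have h2 : Real.cosh (a - b) = 2 * Real.cosh t ^ 2 - 1 := by
    rw [show a - b = 2 * t by rw [ht]; ring, Real.cosh_two_mul]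
    linarith [Real.cosh_sq t]
  have hs0 : 0 ≤ s := by positivity
  have hsp := Real.cosh_pos s
  have h3 : Real.cosh c ^ 2 * (1 + d) = Real.cosh s ^ 2 * (1 + Real.cosh (a - b)) := by
    rw [h1] at hc
    rw [h2]
    linarith
  by_cases hne : a = b
  · have h4 : Real.cosh c ^ 2 < Real.cosh s ^ 2 := by
      rw [hne, sub_self, Real.cosh_zero] at h3
      by_contra! h
      nlinarith [pow_pos hsp 2]
    have h5 := Real.cosh_lt_cosh.mp (lt_of_pow_lt_pow_left₀ 2 hsp.le h4)
    have h6 := sq_lt_sq.mpr h5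
    rw [hs, hne] at h6
    rw [hne]
    linarith
  · have h4 : Real.cosh c ^ 2 ≤ Real.cosh s ^ 2 := by
      by_contra! h
      nlinarith [pow_pos hsp 2]
    have h5 := Real.cosh_le_cosh.mp (le_of_sq_le_sq h4 hsp.le)
    have h6 := sq_le_sq.mpr h5
    have h7 : 0 < (a - b) ^ 2 := by
      have := sub_ne_zero.mpr hne
      positivity
    rw [hs] at h6
    linarith

theorem exists_hyperboloidDist_sq_lt {u v : E} (h : u ≠ v) :
    ∃ z : E, ∀ x, hyperboloidDist x z ^ 2 <
      (hyperboloidDist x u ^ 2 + hyperboloidDist x v ^ 2) / 2 := by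
  obtain ⟨z, hz⟩ := exists_midpoint u v
  refine ⟨z, fun x => ?_⟩
  have ha := hyperboloidDist_nonneg x u
  have hb := hyperboloidDist_nonneg x v
  refine sq_lt_of_cosh_midpoint ha hb (one_lt_lorentz h) ?_ ?_
  · have hg := lorentz_gram x u v
    rw [← cosh_hyperboloidDist x u, ← cosh_hyperboloidDist x v, Real.cosh_sq (hyperboloidDist x u),
      Real.cosh_sq (hyperboloidDist x v), add_sub_cancel_right, add_sub_cancel_right,
      ← mul_pow] at hg
    have hle := abs_le_of_sq_le_sq hg
      (mul_nonneg (Real.sinh_nonneg_iff.mpr ha) (Real.sinh_nonneg_iff.mpr hb))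
    rw [Real.cosh_sub]
    linarith [le_of_abs_le hle]
  · simpa only [cosh_hyperboloidDist] using hz x

theorem continuous_hyperboloidDist (x : E) : Continuous (hyperboloidDist x) := by
  refine Real.continuousOn_arcosh.comp_continuous ?_ (one_le_lorentz x)
  unfold lorentz height
  fun_prop

theorem tendsto_arcosh_atTop : Tendsto Real.arcosh atTop atTop := by
  refine tendsto_atTop_mono' _ ?_ Real.tendsto_log_atTop
  filter_upwards [eventually_ge_atTop 1] with t ht
  exact Real.log_le_log (by linarith) (by linarith [Real.sqrt_nonneg (t ^ 2 - 1)])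

theorem tendsto_hyperboloidDist_cocompact [ProperSpace E] (x : E) :
    Tendsto (hyperboloidDist x) (cocompact E) atTop := by
  refine tendsto_arcosh_atTop.comp ?_
  -- Cauchy–Schwarz gives `lorentz x y ≥ (height x - ‖x‖) * ‖y‖`.
  refine tendsto_atTop_mono (fun y => ?_) ((tendsto_norm_cocompact_atTop (E := E)).const_mul_atTop
    (sub_pos.mpr (norm_lt_height x)))
  have h1 := real_inner_le_norm x y
  have h2 := mul_le_mul_of_nonneg_left (norm_lt_height y).le (height_pos x).le
  unfold lorentz
  linarith

end Hyperboloid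

/-- A weighted sum of squares of coercive continuous functions has a unique minimizer if any two
points have a "midpoint" at which all the squares lie strictly below the average. -/
theorem existsUnique_forall_sum_mul_sq_le {ι X : Type*} [Fintype ι] [TopologicalSpace X]
    [Nonempty X] {D : ι → X → ℝ} {a : ι → ℝ} (ha : ∀ i, 0 ≤ a i) (ha' : ∃ i, 0 < a i)
    (hcont : ∀ i, Continuous (D i)) (hlim : ∀ i, Tendsto (D i) (cocompact X) atTop)
    (hmid : ∀ u v, u ≠ v → ∃ z, ∀ i, D i z ^ 2 < (D i u ^ 2 + D i v ^ 2) / 2) :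
    ∃! v, ∀ u, ∑ i, a i * D i v ^ 2 ≤ ∑ i, a i * D i u ^ 2 := by
  obtain ⟨k, hk⟩ := ha'
  have hf : Continuous fun v => ∑ i, a i * D i v ^ 2 := by fun_prop
  have hflim : Tendsto (fun v => ∑ i, a i * D i v ^ 2) (cocompact X) atTop := by
    refine tendsto_atTop_mono (fun v => ?_)
      (((tendsto_pow_atTop two_ne_zero).comp (hlim k)).const_mul_atTop hk)
    exact Finset.single_le_sum (f := fun i => a i * D i v ^ 2)
      (fun i _ => mul_nonneg (ha i) (sq_nonneg _)) (Finset.mem_univ k)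
  obtain ⟨v, hv⟩ := hf.exists_forall_le hflim
  refine ⟨v, hv, fun u hu => ?_⟩
  by_contra hne
  obtain ⟨z, hz⟩ := hmid u v hne
  have h : ∑ i, a i * D i z ^ 2 < ∑ i, a i * ((D i u ^ 2 + D i v ^ 2) / 2) :=
    Finset.sum_lt_sum (fun i _ => mul_le_mul_of_nonneg_left (hz i).le (ha i))
      ⟨k, Finset.mem_univ k, mul_lt_mul_of_pos_left (hz k) hk⟩
  have h2 : ∑ i, a i * ((D i u ^ 2 + D i v ^ 2) / 2) =
      (∑ i, a i * D i u ^ 2 + ∑ i, a i * D i v ^ 2) / 2 := by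
    rw [← Finset.sum_add_distrib, Finset.sum_div]
    exact Finset.sum_congr rfl fun i _ => by ring
  linarith [hu z, hv z]

/-! ### Chart from the Poincaré ball to the hyperboloid, and the flat case. -/

variable {p : ℕ} {α : ℝ}

/-- The chart from the Poincaré ball to the horizontal coordinate of the unit hyperboloid. -/
noncomputable def toHyperboloid (α : ℝ) (v : EuclideanSpace ℝ (Fin p)) :
    EuclideanSpace ℝ (Fin p) :=
  (2 * √α / (1 - α * ‖v‖ ^ 2)) • v

/-- The inverse of the chart `toHyperboloid`. -/
noncomputable def ofHyperboloid (α : ℝ) (y : EuclideanSpace ℝ (Fin p)) :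
    EuclideanSpace ℝ (Fin p) :=
  (√α * (1 + height y))⁻¹ • y

theorem height_toHyperboloid (hα : 0 < α) {v : EuclideanSpace ℝ (Fin p)}
    (hv : v ∈ poincareBall α p) :
    height (toHyperboloid α v) = (1 + α * ‖v‖ ^ 2) / (1 - α * ‖v‖ ^ 2) := by
  have hv' : 0 < 1 - α * ‖v‖ ^ 2 := sub_pos.mpr hv
  apply height_eq_of_sq
  · positivity
  · rw [toHyperboloid, norm_smul, mul_pow, Real.norm_eq_abs, sq_abs, div_pow, div_pow, mul_pow,
      Real.sq_sqrt hα.le]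
    field_simp
    ring

theorem mul_norm_ofHyperboloid_sq (hα : 0 < α) (y : EuclideanSpace ℝ (Fin p)) :
    α * ‖ofHyperboloid α y‖ ^ 2 = (height y - 1) / (height y + 1) := by
  have h := height_pos y
  have h2 : ‖y‖ ^ 2 = (height y - 1) * (height y + 1) := by linarith [height_sq y]
  rw [ofHyperboloid, norm_smul, mul_pow, Real.norm_eq_abs, sq_abs, h2, inv_pow, mul_pow,
    Real.sq_sqrt hα.le]
  field_simp
  ring

theorem ofHyperboloid_mem (hα : 0 < α) (y : EuclideanSpace ℝ (Fin p)) :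
    ofHyperboloid α y ∈ poincareBall α p := by
  have h := height_pos y
  rw [poincareBall, Set.mem_ofPred_eq, mul_norm_ofHyperboloid_sq hα, div_lt_one (by linarith)]
  linarith

theorem toHyperboloid_ofHyperboloid (hα : 0 < α) (y : EuclideanSpace ℝ (Fin p)) :
    toHyperboloid α (ofHyperboloid α y) = y := by
  have h := height_pos y
  have hs := Real.sqrt_pos.mpr hα
  rw [toHyperboloid, mul_norm_ofHyperboloid_sq hα, ofHyperboloid, smul_smul]
  convert one_smul ℝ y
  have : 1 - (height y - 1) / (height y + 1) = 2 / (height y + 1) := by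
    field_simp
    ring
  rw [this]
  field_simp
  ring

theorem ofHyperboloid_toHyperboloid (hα : 0 < α) {v : EuclideanSpace ℝ (Fin p)}
    (hv : v ∈ poincareBall α p) : ofHyperboloid α (toHyperboloid α v) = v := by
  have hv' : 0 < 1 - α * ‖v‖ ^ 2 := sub_pos.mpr hv
  have hs := Real.sqrt_pos.mpr hα
  rw [ofHyperboloid, height_toHyperboloid hα hv, toHyperboloid, smul_smul]
  convert one_smul ℝ v
  have : 1 + (1 + α * ‖v‖ ^ 2) / (1 - α * ‖v‖ ^ 2) = 2 / (1 - α * ‖v‖ ^ 2) := by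
    field_simp
    ring
  rw [this]
  field_simp

theorem lorentz_toHyperboloid (hα : 0 < α) {v w : EuclideanSpace ℝ (Fin p)}
    (hv : v ∈ poincareBall α p) (hw : w ∈ poincareBall α p) :
    lorentz (toHyperboloid α v) (toHyperboloid α w) =
      1 + 2 * (α * ‖v - w‖ ^ 2 / ((1 - α * ‖v‖ ^ 2) * (1 - α * ‖w‖ ^ 2))) := by
  have hv' : 0 < 1 - α * ‖v‖ ^ 2 := sub_pos.mpr hv
  have hw' : 0 < 1 - α * ‖w‖ ^ 2 := sub_pos.mpr hw
  rw [lorentz, height_toHyperboloid hα hv, height_toHyperboloid hα hw, toHyperboloid,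
    toHyperboloid, inner_smul_left, inner_smul_right, RCLike.conj_to_real, norm_sub_sq_real]
  have hs := Real.sq_sqrt hα.le
  field_simp
  rw [hs]
  ring

theorem mobiusAdd_denom_eq (α : ℝ) (v w : EuclideanSpace ℝ (Fin p)) :
    1 + 2 * α * inner ℝ (-v) w + α ^ 2 * ‖-v‖ ^ 2 * ‖w‖ ^ 2 =
      (1 - α * ‖v‖ ^ 2) * (1 - α * ‖w‖ ^ 2) + α * ‖v - w‖ ^ 2 := by
  rw [inner_neg_left, norm_neg, norm_sub_sq_real]
  ring

theorem norm_mobiusAdd_neg_sq (hα : 0 ≤ α) {v w : EuclideanSpace ℝ (Fin p)}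
    (hv : v ∈ poincareBall α p) (hw : w ∈ poincareBall α p) :
    ‖mobiusAdd α (-v) w‖ ^ 2 =
      ‖v - w‖ ^ 2 / ((1 - α * ‖v‖ ^ 2) * (1 - α * ‖w‖ ^ 2) + α * ‖v - w‖ ^ 2) := by
  have hv' : 0 < 1 - α * ‖v‖ ^ 2 := sub_pos.mpr hv
  have hw' : 0 < 1 - α * ‖w‖ ^ 2 := sub_pos.mpr hw
  have hden : 0 < (1 - α * ‖v‖ ^ 2) * (1 - α * ‖w‖ ^ 2) + α * ‖v - w‖ ^ 2 := by positivity
  rw [mobiusAdd, mobiusAdd_denom_eq, norm_smul, mul_pow, Real.norm_eq_abs, sq_abs, inv_pow,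
    inv_mul_eq_div, div_eq_div_iff (by positivity) hden.ne', norm_add_sq_real, norm_smul,
    norm_smul, mul_pow, mul_pow, Real.norm_eq_abs, Real.norm_eq_abs, sq_abs, sq_abs,
    inner_smul_left, inner_smul_right, RCLike.conj_to_real, inner_neg_left, norm_neg,
    norm_sub_sq_real]
  ring

theorem cosh_two_mul_artanh {t : ℝ} (ht : t ∈ Set.Ioo (-1) 1) :
    Real.cosh (2 * Real.artanh t) = (1 + t ^ 2) / (1 - t ^ 2) := by
  have h : 0 < 1 - t ^ 2 := by nlinarith [ht.1, ht.2]
  rw [Real.cosh_two_mul, Real.cosh_artanh ht, Real.sinh_artanh ht, div_pow, div_pow,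
    Real.sq_sqrt h.le, one_pow, add_div]

theorem hypDist_eq_hyperboloidDist (hα : 0 < α) {v w : EuclideanSpace ℝ (Fin p)}
    (hv : v ∈ poincareBall α p) (hw : w ∈ poincareBall α p) :
    hypDist α v w = (√α)⁻¹ * hyperboloidDist (toHyperboloid α v) (toHyperboloid α w) := by
  have hv' : 0 < 1 - α * ‖v‖ ^ 2 := sub_pos.mpr hv
  have hw' : 0 < 1 - α * ‖w‖ ^ 2 := sub_pos.mpr hw
  rw [hypDist, if_neg hα.ne', hyperboloidDist, lorentz_toHyperboloid hα hv hw]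
  set t := √α * ‖mobiusAdd α (-v) w‖ with ht
  set P := (1 - α * ‖v‖ ^ 2) * (1 - α * ‖w‖ ^ 2) with hP
  set Q := α * ‖v - w‖ ^ 2 with hQ
  have hP0 : 0 < P := mul_pos hv' hw'
  have hQ0 : 0 ≤ Q := by positivity
  have ht0 : 0 ≤ t := by positivity
  have ht2 : t ^ 2 = Q / (P + Q) := by
    rw [ht, mul_pow, Real.sq_sqrt hα.le, norm_mobiusAdd_neg_sq hα.le hv hw, mul_div_assoc]
  have ht1 : t < 1 := by
    have : t ^ 2 < 1 := by
      rw [ht2, div_lt_one (by linarith)]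
      linarith
    exact (sq_lt_one_iff₀ ht0).mp this
  -- Since `t ^ 2 = Q / (P + Q)`, the ratio `(1 + t ^ 2) / (1 - t ^ 2)` is `(P + 2 * Q) / P`.
  have h1 : 1 + 2 * (Q / P) = Real.cosh (2 * Real.artanh t) := by
    rw [cosh_two_mul_artanh ⟨by linarith, ht1⟩, ht2]
    have : 1 - Q / (P + Q) = P / (P + Q) := by
      field_simp
      ring
    rw [this]
    field_simp
    ring
  rw [h1, Real.arcosh_cosh (mul_nonneg zero_le_two (Real.artanh_nonneg ht0))]
  ring

theorem hypDist_zero (v w : EuclideanSpace ℝ (Fin p)) : hypDist 0 v w = 2 * dist w v := by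
  rw [hypDist, if_pos rfl, mobiusAdd, dist_eq_norm]
  congr 2
  simp
  abel

theorem exists_two_mul_dist_sq_lt {E : Type*} [NormedAddCommGroup E] [InnerProductSpace ℝ E]
    {u v : E} (h : u ≠ v) :
    ∃ z : E, ∀ x, (2 * dist z x) ^ 2 < ((2 * dist u x) ^ 2 + (2 * dist v x) ^ 2) / 2 := by
  refine ⟨(2⁻¹ : ℝ) • (u + v), fun x => ?_⟩
  have h1 : 0 < ‖u - v‖ := norm_pos_iff.mpr (sub_ne_zero.mpr h)
  have h2 := parallelogram_law_with_norm ℝ (u - x) (v - x)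
  have h3 : (2⁻¹ : ℝ) • (u + v) - x = (2⁻¹ : ℝ) • ((u - x) + (v - x)) := by module
  rw [sub_sub_sub_cancel_right] at h2
  rw [dist_eq_norm, dist_eq_norm, dist_eq_norm, h3, norm_smul, Real.norm_of_nonneg (by norm_num)]
  -- The gap between the two sides is exactly `‖u - v‖ ^ 2`.
  nlinarith [mul_pos h1 h1]

end HypeFCM

theorem mainTheorem2 (α : ℝ) (hα : 0 ≤ α) (p n c : ℕ) (m : ℝ) (hm : 0 < m)
    (x : Fin n → EuclideanSpace ℝ (Fin p)) (hx : ∀ i, x i ∈ HypeFCM.poincareBall α p)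
    (w : Fin n → Fin c → ℝ) (j : Fin c) (hw : ∀ i, 0 ≤ w i j) (hw_ne : ∃ i, w i j ≠ 0) :
    ∃! v : EuclideanSpace ℝ (Fin p), v ∈ HypeFCM.poincareBall α p ∧
      IsMinOn (HypeFCM.centroidObjective α x w m j) (HypeFCM.poincareBall α p) v := by
  open HypeFCM in
  have ha : ∀ i, 0 ≤ w i j ^ m := fun i => Real.rpow_nonneg (hw i) m
  have ha' : ∃ i, 0 < w i j ^ m := by
    obtain ⟨i, hi⟩ := hw_ne
    exact ⟨i, Real.rpow_pos_of_pos ((hw i).lt_of_ne' hi) m⟩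
  rcases hα.eq_or_lt with rfl | hpos
  · have hball : poincareBall 0 p = Set.univ := by
      ext v
      simp [poincareBall]
    have hlim : ∀ i, Filter.Tendsto (fun v => 2 * dist v (x i))
        (Filter.cocompact (EuclideanSpace ℝ (Fin p))) Filter.atTop := fun i =>
      (tendsto_dist_right_cocompact_atTop (x i)).const_mul_atTop two_pos
    have key := existsUnique_forall_sum_mul_sq_le (D := fun i v => 2 * dist v (x i)) ha ha'
      (fun i => by fun_prop) hlim fun u v huv =>
        (exists_two_mul_dist_sq_lt huv).imp fun z hz i => hz (x i)
    simpa [hball, isMinOn_iff, centroidObjective, hypDist_zero] using key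
  · have hobj : ∀ v ∈ poincareBall α p, centroidObjective α x w m j v =
        (√α)⁻¹ ^ 2 * ∑ i, w i j ^ m *
          hyperboloidDist (toHyperboloid α (x i)) (toHyperboloid α v) ^ 2 := by
      intro v hv
      rw [centroidObjective, Finset.mul_sum]
      refine Finset.sum_congr rfl fun i _ => ?_
      rw [hypDist_eq_hyperboloidDist hpos (hx i) hv]
      ring
    have hk : 0 < (√α)⁻¹ ^ 2 := by positivity
    obtain ⟨y, hy, huniq⟩ := existsUnique_forall_sum_mul_sq_le
      (D := fun i => hyperboloidDist (toHyperboloid α (x i))) ha ha'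
      (fun i => continuous_hyperboloidDist _) (fun i => tendsto_hyperboloidDist_cocompact _)
      fun u v huv => (exists_hyperboloidDist_sq_lt huv).imp fun z hz i => hz _
    refine ⟨ofHyperboloid α y, ⟨ofHyperboloid_mem hpos y, fun u hu => ?_⟩, fun v hv => ?_⟩
    · rw [Set.mem_ofPred_eq, hobj _ hu, hobj _ (ofHyperboloid_mem hpos y),
        toHyperboloid_ofHyperboloid hpos]
      exact mul_le_mul_of_nonneg_left (hy _) hk.le
    -- The chart is onto, so a minimizer in the ball maps to a minimizer on the hyperboloid.
    · rw [← huniq (toHyperboloid α v) fun z => ?_, ofHyperboloid_toHyperboloid hpos hv.1]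
      have h := isMinOn_iff.mp hv.2 _ (ofHyperboloid_mem hpos z)
      rw [hobj _ hv.1, hobj _ (ofHyperboloid_mem hpos z), toHyperboloid_ofHyperboloid hpos] at h
      exact le_of_mul_le_mul_left h hk
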